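/- Let $\mathbb{T}^d=\mathbb{R}^d/\mathbb{Z}^d$ carry the normalised Lebesgue measure, let $T>0$, $b,\eta\in L^\infty(\mathbb{T}^d;\mathbb{R}^d)$ and $p_0\in L^2(\mathbb{T}^d)$. For $\delta\in[0,1)$ let $$p^{\delta,p_0}\in C([0,T];L^2(\mathbb{T}^d))\cap L^2(0,T;H^1(\mathbb{T}^d))\cap H^1(0,T;H^{-1}(\mathbb{T}^d))$$ be the (unique) variational solution of the Fokker–Planck equation $$\partial_t p^{\delta,p_0}=\tfrac12\Delta p^{\delta,p_0}-\operatorname{div}\big(p^{\delta,p_0}(b+\delta\eta)\big)\ \text{ in }(0,T)\times\mathbb{T}^d,\qquad p^{\delta,p_0}|_{t=0}=p_0,$$ and let $\dot r^{p_0}$ be the (unique) variational solution, in the same class, of the linearised forced equation $$\partial_t\dot r^{p_0}=\tfrac12\Delta\dot r^{p_0}-\operatorname{div}(b\,\dot r^{p_0})-\operatorname{div}(\eta\,p^{0,p_0})\ \text{ in }(0,T)\times\mathbb{T}^d,\qquad \dot r^{p_0}|_{t=0}=0.$$ For $\delta\in(0,1)$ and $t\in[0,T]$ put $r^{\delta,p_0}(t):=\delta^{-1}\big(p^{\delta,p_0}(t)-p^{0,p_0}(t)\big)$.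 Then there is a constant $C=C(\|b\|_\infty,\|\eta\|_\infty,T,d)>0$ such that for all $\tau\in(0,T)$ and $\delta\in(0,1)$ $$\big\|r^{\delta,p_0}(\tau)-\dot r^{p_0}(\tau)\big\|_2\le C\,\delta\,\tau\,\|p_0\|_2 .$$ In particular, for all $\delta\in(0,1)$, $$\sup_{0\le\tau\le T}\big\|r^{\delta,p_0}(\tau)-\dot r^{p_0}(\tau)\big\|_2\le C\,\delta\,T\,\|p_0\|_2 ,$$ and for every $\tau\in[0,T]$ the difference quotient $r^{\delta,p_0}(\tau)$ converges to $\dot r^{p_0}(\tau)$ in $L^2(\mathbb{T}^d)$ as $\delta\to0^+$. -/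

import Mathlib

namespace TorusFP

open MeasureTheory Set
open scoped ENNReal ContDiff

/-- The normalised Lebesgue (Haar) measure on the flat torus `𝕋ᵈ = ℝᵈ / ℤᵈ`. -/
noncomputable abbrev torusMeasure (d : ℕ) : Measure (UnitAddTorus (Fin d)) :=
  Measure.pi fun _ => AddCircle.haarAddCircle

/-- `L²(𝕋ᵈ)`, real valued. -/
abbrev L2 (d : ℕ) : Type :=
  Lp ℝ 2 (torusMeasure d)

/-- `L²(𝕋ᵈ; ℝᵈ)`, with the Euclidean norm on `ℝᵈ`. -/
abbrev L2Vec (d : ℕ) : Type :=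
  Lp (EuclideanSpace ℝ (Fin d)) 2 (torusMeasure d)

/-- `L^∞(𝕋ᵈ; ℝᵈ)`, with the essential supremum of the Euclidean norm. -/
abbrev LInftyVec (d : ℕ) : Type :=
  Lp (EuclideanSpace ℝ (Fin d)) ∞ (torusMeasure d)

/-- `φ ∈ C^∞(𝕋ᵈ)`: the `ℤᵈ`-periodic lift of `φ` to `ℝᵈ` is smooth. -/
def IsSmooth {d : ℕ} (φ : UnitAddTorus (Fin d) → ℝ) : Prop :=
  ContDiff ℝ ∞ fun x : Fin d → ℝ => φ fun i => (x i : UnitAddCircle)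

/-- The partial derivative `∂ᵢ φ` of a function on the torus. -/
noncomputable def partialDeriv {d : ℕ} (i : Fin d) (φ : UnitAddTorus (Fin d) → ℝ)
    (y : UnitAddTorus (Fin d)) : ℝ :=
  deriv (fun s : ℝ => φ (y + Pi.single i (s : UnitAddCircle))) 0

/-- `Du ∈ L²(𝕋ᵈ; ℝᵈ)` is the weak gradient of `u ∈ L²(𝕋ᵈ)`. Thus `u ∈ H¹(𝕋ᵈ)` if and only if
`u` has a weak gradient. -/
def IsWeakGradient {d : ℕ} (u : L2 d) (Du : L2Vec d) : Prop :=
  ∀ φ : UnitAddTorus (Fin d) → ℝ, IsSmooth φ → ∀ i : Fin d,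
    ∫ y, u y * partialDeriv i φ y ∂torusMeasure d = -∫ y, Du y i * φ y ∂torusMeasure d

/-- `u` is a variational solution on `[0, T]` of the parabolic problem
`∂ₜ u = ½ Δ u - div (g u) - div F`, `u(0) = u₀` on the torus:
`u ∈ C([0, T]; L²) ∩ L²(0, T; H¹)` with `u(0) = u₀`, and, for every `v ∈ H¹`,
`d/dt ⟨u(t), v⟩ = - ½ ∫ ∇u(t) · ∇v + ∫ (u(t) g + F(t)) · ∇v`, in time-integrated form.
If `F ∈ L²(0, T; L²)`, the right-hand side is an element of `L²(0, T; H⁻¹)` applied to `v`, so that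
the last condition says that `u ∈ H¹(0, T; H⁻¹)` and that its derivative is given by the
equation. -/
structure IsVariationalSolution {d : ℕ} (T : ℝ) (g : LInftyVec d)
    (F : ℝ → UnitAddTorus (Fin d) → EuclideanSpace ℝ (Fin d)) (u₀ : L2 d) (u : ℝ → L2 d) :
    Prop where
  continuousOn : ContinuousOn u (Icc 0 T)
  initial : u 0 = u₀
  exists_gradient : ∃ Du : ℝ → L2Vec d,
    MemLp Du 2 (volume.restrict (Ioo 0 T)) ∧
    (∀ᵐ t ∂volume.restrict (Ioo 0 T), IsWeakGradient (u t) (Du t)) ∧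
    ∀ (v : L2 d) (Dv : L2Vec d), IsWeakGradient v Dv → ∀ t ∈ Icc 0 T,
      ∫ y, u t y * v y ∂torusMeasure d =
        ∫ y, u₀ y * v y ∂torusMeasure d +
          ∫ s in 0..t,
            (-(1 / 2) * ∫ y, inner ℝ (Du s y) (Dv y) ∂torusMeasure d +
              ∫ y, inner ℝ (u s y • g y + F s y) (Dv y) ∂torusMeasure d)

/-- `p` is the variational solution on `[0, T]` of the Fokker–Planck equation
`∂ₜ p = ½ Δ p - div (p g)`, `p(0) = p₀`, with drift `g`. -/
def IsFokkerPlanckSolution {d : ℕ} (T : ℝ) (g : LInftyVec d) (p₀ : L2 d) (p : ℝ → L2 d) : Prop :=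
  IsVariationalSolution T g (fun _ _ => 0) p₀ p

/-- `r` is the variational solution on `[0, T]` of the linearised equation
`∂ₜ r = ½ Δ r - div (b r) - div (η p)`, `r(0) = 0`, forced by `p`. -/
def IsLinearisedSolution {d : ℕ} (T : ℝ) (b η : LInftyVec d) (p : ℝ → L2 d) (r : ℝ → L2 d) :
    Prop :=
  IsVariationalSolution T b (fun t y => p t y • η y) 0 r

end TorusFP

namespace TorusFP

open MeasureTheory Set Filter Topology
open scoped ENNReal ContDiff RealInnerProductSpace

/-! ### Steklov averages over time windows -/

section Averages

variable {E : Type*} [NormedAddCommGroup E] [NormedSpace ℝ E] [CompleteSpace E]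

/-! Everything rests on one energy estimate, `‖u t‖² ≤ ‖u 0‖² + ∫ ‖f‖²` for `u' = -½ D⋆ D u + D⋆ f`.
It is proved without differentiating `‖u‖²`: testing the equation on `[s, t]` with `∫ u`, whose
gradient is `∫ Du`, gives `IsWeakSolution.inner_integral_sub_le`. This controls the derivative of
the squared norm of a window integral of `u`, and shrinking the window gives the estimate. With the
drift inside `f`, Grönwall yields `IsWeakSolution.norm_sq_le_of_norm_source_le`, which is used three
times: `p^δ` is bounded uniformly in `δ`; the quotient `r^δ` starts at zero with source `b r^δ + η
p^δ`, so `‖r^δ‖² = O(τ)`; the remainder `R = r^δ - ṙ` starts at zero with source `b R + δ η r^δ`, so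
`‖R‖² = O(δ² τ²)`. -/

lemma hasDerivAt_integral_window {u : ℝ → E} (hu : Continuous u) (h s : ℝ) :
    HasDerivAt (fun s => ∫ x in s..(s + h), u x) (u (s + h) - u s) s := by
  have key : ∀ s, ∫ x in s..(s + h), u x = (∫ x in 0..(s + h), u x) - ∫ x in 0..s, u x :=
    fun s => (intervalIntegral.integral_interval_sub_left
      (hu.intervalIntegrable _ _) (hu.intervalIntegrable _ _)).symm
  simp_rw [key]
  exact ((hu.integral_hasStrictDerivAt 0 (s + h)).hasDerivAt.comp_add_const s h).sub
    (hu.integral_hasStrictDerivAt 0 s).hasDerivAt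

lemma tendsto_average_window {u : ℝ → E} (hu : Continuous u) (s : ℝ) :
    Tendsto (fun h : ℝ => h⁻¹ • ∫ x in s..(s + h), u x) (𝓝[>] 0) (𝓝 (u s)) := by
  have := (hu.integral_hasStrictDerivAt s s).hasDerivAt.tendsto_slope_zero_right
  simpa using this

end Averages

/-! ### Energy inequality from an increment inequality -/

section Energy

variable {H G : Type*} [NormedAddCommGroup H] [InnerProductSpace ℝ H] [CompleteSpace H]
  [NormedAddCommGroup G] [InnerProductSpace ℝ G] [CompleteSpace G]

/-- The window integral `W` is differentiable although `u` is only continuous, and `(‖W‖²)' = 2⟪W, u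
(s + h) - u s⟫` is bounded by the hypothesis. Integrate in `s` and divide by `h²`. -/
lemma norm_sq_average_le {u : ℝ → H} {f : ℝ → G} (hu : Continuous u) (hf : Continuous f) {T : ℝ}
    (huf : ∀ s t, 0 ≤ s → s ≤ t → t ≤ T →
      ⟪∫ x in s..t, u x, u t - u s⟫ ≤ 1 / 2 * ‖∫ x in s..t, f x‖ ^ 2)
    {t h : ℝ} (ht : 0 ≤ t) (hh : 0 < h) (hT : t + h ≤ T) :
    ‖h⁻¹ • ∫ x in t..(t + h), u x‖ ^ 2 ≤
      ‖h⁻¹ • ∫ x in (0 : ℝ)..(0 + h), u x‖ ^ 2 +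
        ∫ s in 0..t, ‖h⁻¹ • ∫ x in s..(s + h), f x‖ ^ 2 := by
  have hW := fun s => hasDerivAt_integral_window hu h s
  have hcW : Continuous fun s => ∫ x in s..(s + h), u x :=
    continuous_iff_continuousAt.2 fun s => (hW s).continuousAt
  have hcF : Continuous fun s => ∫ x in s..(s + h), f x :=
    continuous_iff_continuousAt.2 fun s => (hasDerivAt_integral_window hf h s).continuousAt
  have hcd : Continuous fun s => 2 * ⟪∫ x in s..(s + h), u x, u (s + h) - u s⟫ := by
    have : Continuous fun s => u (s + h) - u s := by fun_prop
    exact continuous_const.mul (hcW.inner this)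
  have ftc := intervalIntegral.integral_eq_sub_of_hasDerivAt
    (fun s _ => (hW s).norm_sq) (hcd.intervalIntegrable 0 t)
  have hle : ∫ s in 0..t, 2 * ⟪∫ x in s..(s + h), u x, u (s + h) - u s⟫ ≤
      ∫ s in 0..t, ‖∫ x in s..(s + h), f x‖ ^ 2 := by
    refine intervalIntegral.integral_mono_on ht (hcd.intervalIntegrable _ _)
      ((hcF.norm.pow 2).intervalIntegrable _ _) fun s hs => ?_
    have := huf s (s + h) hs.1 (by linarith) (by linarith [hs.2])
    linarith
  simp_rw [norm_smul, mul_pow]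
  rw [intervalIntegral.integral_const_mul, ← mul_add]
  exact mul_le_mul_of_nonneg_left (by linarith) (by positivity)

lemma norm_sq_le_of_increment_lt {u : ℝ → H} {f : ℝ → G} (hu : Continuous u) (hf : Continuous f)
    {T : ℝ}
    (huf : ∀ s t, 0 ≤ s → s ≤ t → t ≤ T →
      ⟪∫ x in s..t, u x, u t - u s⟫ ≤ 1 / 2 * ‖∫ x in s..t, f x‖ ^ 2)
    {t : ℝ} (ht : 0 ≤ t) (hT : t < T) :
    ‖u t‖ ^ 2 ≤ ‖u 0‖ ^ 2 + ∫ s in 0..t, ‖f s‖ ^ 2 := by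
  obtain ⟨M, hM⟩ := (isCompact_Icc (a := (0 : ℝ)) (b := T)).exists_bound_of_continuousOn
    hf.continuousOn
  -- Since `t < T`, short windows starting in `[0, t]` stay in `[0, T]`, where `M` bounds `f`; this
  -- justifies dominated convergence.
  have hev : ∀ᶠ h in 𝓝[>] (0 : ℝ), 0 < h ∧ t + h ≤ T := by
    filter_upwards [Ioo_mem_nhdsGT (sub_pos.2 hT)] with h hh
    exact ⟨hh.1, by linarith [hh.2]⟩
  refine le_of_tendsto_of_tendsto ((tendsto_average_window hu t).norm.pow 2)
    (((tendsto_average_window hu 0).norm.pow 2).add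
      (intervalIntegral.tendsto_integral_filter_of_dominated_convergence (fun _ => M ^ 2)
        (F := fun (h s : ℝ) => ‖h⁻¹ • ∫ x in s..(s + h), f x‖ ^ 2) ?_ ?_ ?_ ?_))
    (hev.mono fun h hh => norm_sq_average_le hu hf huf ht hh.1 hh.2)
  · refine Eventually.of_forall fun h => Continuous.aestronglyMeasurable ?_
    have hcF : Continuous fun s => ∫ x in s..(s + h), f x :=
      continuous_iff_continuousAt.2 fun s => (hasDerivAt_integral_window hf h s).continuousAt
    exact ((hcF.const_smul _).norm.pow 2)
  · filter_upwards [hev] with h hh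
    refine Eventually.of_forall fun s hs => ?_
    rw [uIoc_of_le ht] at hs
    have hb : ‖∫ x in s..(s + h), f x‖ ≤ M * |s + h - s| := by
      refine intervalIntegral.norm_integral_le_of_norm_le_const fun x hx => hM x ?_
      rw [uIoc_of_le (by linarith [hh.1])] at hx
      exact ⟨by linarith [hx.1, hs.1], by linarith [hx.2, hs.2, hh.2]⟩
    rw [add_sub_cancel_left, abs_of_pos hh.1] at hb
    rw [norm_pow, norm_norm, norm_smul, norm_inv, Real.norm_of_nonneg hh.1.le]
    refine pow_le_pow_left₀ (by have := hh.1; positivity) ?_ 2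
    rw [inv_mul_le_iff₀ hh.1]
    linarith
  · exact intervalIntegrable_const
  · exact Eventually.of_forall fun s _ => (tendsto_average_window hf s).norm.pow 2

lemma norm_sq_le_of_increment {u : ℝ → H} {f : ℝ → G} {T : ℝ} (hT : 0 < T)
    (hu : ContinuousOn u (Icc 0 T)) (hf : ContinuousOn f (Icc 0 T))
    (huf : ∀ s t, 0 ≤ s → s ≤ t → t ≤ T →
      ⟪∫ x in s..t, u x, u t - u s⟫ ≤ 1 / 2 * ‖∫ x in s..t, f x‖ ^ 2)
    {t : ℝ} (ht : t ∈ Icc 0 T) :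
    ‖u t‖ ^ 2 ≤ ‖u 0‖ ^ 2 + ∫ s in 0..t, ‖f s‖ ^ 2 := by
  set u' := IccExtend hT.le ((Icc 0 T).domRestrict u)
  set f' := IccExtend hT.le ((Icc 0 T).domRestrict f)
  have hu' : Continuous u' := (continuousOn_iff_continuous_domRestrict.1 hu).Icc_extend'
  have hf' : Continuous f' := (continuousOn_iff_continuous_domRestrict.1 hf).Icc_extend'
  have eu : ∀ x ∈ Icc 0 T, u' x = u x := fun x hx => IccExtend_of_mem _ _ hx
  have ef : ∀ x ∈ Icc 0 T, f' x = f x := fun x hx => IccExtend_of_mem _ _ hx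
  have huf' : ∀ s t, 0 ≤ s → s ≤ t → t ≤ T →
      ⟪∫ x in s..t, u' x, u' t - u' s⟫ ≤ 1 / 2 * ‖∫ x in s..t, f' x‖ ^ 2 := by
    intro s t hs hst ht
    have hsub : ∀ x ∈ uIcc s t, x ∈ Icc 0 T := fun x hx => by
      rw [uIcc_of_le hst] at hx
      exact ⟨hs.trans hx.1, hx.2.trans ht⟩
    rw [intervalIntegral.integral_congr fun x hx => eu x (hsub x hx),
      intervalIntegral.integral_congr fun x hx => ef x (hsub x hx),
      eu t ⟨hs.trans hst, ht⟩, eu s ⟨hs, hst.trans ht⟩]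
    exact huf s t hs hst ht
  -- The endpoint `t = T`, where no forward window fits, is reached by continuity.
  have key : ∀ t ∈ Icc 0 T, ‖u' t‖ ^ 2 ≤ ‖u' 0‖ ^ 2 + ∫ s in 0..t, ‖f' s‖ ^ 2 := by
    have hcl : IsClosed {t | ‖u' t‖ ^ 2 ≤ ‖u' 0‖ ^ 2 + ∫ s in 0..t, ‖f' s‖ ^ 2} :=
      isClosed_le (hu'.norm.pow 2) (continuous_const.add
        (intervalIntegral.continuous_primitive
          (fun _ _ => (hf'.norm.pow 2).intervalIntegrable _ _) 0))
    rw [← closure_Ico hT.ne]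
    exact closure_minimal (fun t ht => norm_sq_le_of_increment_lt hu' hf' huf' ht.1 ht.2) hcl
  have := key t ht
  rwa [eu t ht, eu 0 ⟨le_rfl, hT.le⟩, intervalIntegral.integral_congr fun x hx => ?_] at this
  rw [uIcc_of_le ht.1] at hx
  simp only [ef x ⟨hx.1, hx.2.trans ht.2⟩]

end Energy

/-- Grönwall's inequality in integral form. -/
lemma gronwall_integral {y : ℝ → ℝ} {a c T : ℝ} (hy : ContinuousOn y (Icc 0 T)) (ha : 0 ≤ a)
    (h : ∀ t ∈ Icc 0 T, y t ≤ c + ∫ s in 0..t, a * y s) :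
    ∀ t ∈ Icc 0 T, y t ≤ c * Real.exp (a * t) := by
  intro t ht
  have hT : 0 ≤ T := ht.1.trans ht.2
  set y' := IccExtend hT ((Icc 0 T).domRestrict y)
  have hy' : Continuous y' := (continuousOn_iff_continuous_domRestrict.1 hy).Icc_extend'
  have ey : ∀ x ∈ Icc 0 T, y' x = y x := fun x hx => IccExtend_of_mem _ _ hx
  have h' : ∀ t ∈ Icc 0 T, y' t ≤ c + ∫ s in 0..t, a * y' s := fun t ht => by
    rw [ey t ht, intervalIntegral.integral_congr (g := fun s => a * y s) fun x hx => ?_]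
    · exact h t ht
    rw [uIcc_of_le ht.1] at hx
    simp only [ey x ⟨hx.1, hx.2.trans ht.2⟩]
  have hd : ∀ t, HasDerivAt (fun t => c + ∫ s in 0..t, a * y' s) (a * y' t) t := fun t =>
    ((continuous_const.mul hy').integral_hasStrictDerivAt 0 t).hasDerivAt.const_add c
  -- The differential inequality is applied to the right-hand side, which is differentiable, rather
  -- than to `y`.
  have := le_gronwallBound_of_liminf_deriv_right_le (f := fun t => c + ∫ s in 0..t, a * y' s)
    (f' := fun t => a * y' t) (δ := c) (K := a) (ε := 0) (a := 0) (b := T)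
    (fun t _ => (hd t).continuousAt.continuousWithinAt)
    (fun t _ r hr => (hd t).hasDerivWithinAt.liminf_right_slope_le hr)
    (by simp) (fun t ht => by
      have := mul_le_mul_of_nonneg_left (h' t ⟨ht.1, ht.2.le⟩) ha
      simpa using this) t ht
  rw [gronwallBound_ε0, sub_zero] at this
  rw [← ey t ht]
  exact (h' t ht).trans this

/-! ### Abstract weak solutions and their energy estimate -/

section WeakSolution

variable {H G : Type*} [NormedAddCommGroup H] [InnerProductSpace ℝ H]
  [NormedAddCommGroup G] [InnerProductSpace ℝ G]

/-- Weak solutions on `[0, T]` of `u' = -½ D⋆ D u + D⋆ f`, where the closed operator `D` from `H`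
to `G` is given by its graph `Γ`. -/
structure IsWeakSolution (Γ : Submodule ℝ (H × G)) (T : ℝ) (f : ℝ → G) (u : ℝ → H) : Prop where
  continuousOn : ContinuousOn u (Icc 0 T)
  continuousOn_source : ContinuousOn f (Icc 0 T)
  exists_gradient : ∃ Du : ℝ → G, IntegrableOn Du (Ioo 0 T) ∧
    (∀ᵐ t ∂volume.restrict (Ioo 0 T), (u t, Du t) ∈ Γ) ∧
    ∀ v ∈ Γ, ∀ t ∈ Icc 0 T,
      ⟪u t, v.1⟫ = ⟪u 0, v.1⟫ + ∫ s in 0..t, ⟪-(1 / 2 : ℝ) • Du s + f s, v.2⟫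

variable {Γ : Submodule ℝ (H × G)} {T : ℝ} {f f₁ f₂ : ℝ → G} {u u₁ u₂ : ℝ → H}

lemma intervalIntegrable_of_integrableOn_Ioo {E : Type*} [NormedAddCommGroup E] {g : ℝ → E}
    (hg : IntegrableOn g (Ioo 0 T)) {s t : ℝ} (hs : 0 ≤ s) (hst : s ≤ t) (ht : t ≤ T) :
    IntervalIntegrable g volume s t := by
  rw [intervalIntegrable_iff_integrableOn_Ioo_of_le hst]
  exact hg.mono_set (Ioo_subset_Ioo hs ht)

lemma intervalIntegrable_of_continuousOn_Icc {E : Type*} [NormedAddCommGroup E] {g : ℝ → E}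
    (hg : ContinuousOn g (Icc 0 T)) {s t : ℝ} (hs : 0 ≤ s) (hst : s ≤ t) (ht : t ≤ T) :
    IntervalIntegrable g volume s t :=
  (hg.mono (by rw [uIcc_of_le hst]; exact Icc_subset_Icc hs ht)).intervalIntegrable

lemma intervalIntegrable_inner_flux {Du : ℝ → G} (hD : IntegrableOn Du (Ioo 0 T))
    (hf : ContinuousOn f (Icc 0 T)) {s t : ℝ} (hs : 0 ≤ s) (hst : s ≤ t) (ht : t ≤ T) (v : G) :
    IntervalIntegrable (fun x => ⟪-(1 / 2 : ℝ) • Du x + f x, v⟫) volume s t := by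
  have := ((intervalIntegrable_of_integrableOn_Ioo hD hs hst ht).smul (-(1 / 2 : ℝ))).add
    (intervalIntegrable_of_continuousOn_Icc hf hs hst ht)
  exact ⟨this.1.inner_const v, this.2.inner_const v⟩

lemma IsWeakSolution.sub (h₁ : IsWeakSolution Γ T f₁ u₁) (h₂ : IsWeakSolution Γ T f₂ u₂) :
    IsWeakSolution Γ T (fun t => f₁ t - f₂ t) (fun t => u₁ t - u₂ t) := by
  obtain ⟨D₁, hi₁, hg₁, he₁⟩ := h₁.exists_gradient
  obtain ⟨D₂, hi₂, hg₂, he₂⟩ := h₂.exists_gradient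
  refine ⟨h₁.continuousOn.sub h₂.continuousOn,
    h₁.continuousOn_source.sub h₂.continuousOn_source, fun t => D₁ t - D₂ t, hi₁.sub hi₂, ?_, ?_⟩
  · filter_upwards [hg₁, hg₂] with t h₁ h₂ using Γ.sub_mem h₁ h₂
  · intro v hv t ht
    rw [inner_sub_left, inner_sub_left, he₁ v hv t ht, he₂ v hv t ht, add_sub_add_comm,
      ← intervalIntegral.integral_sub
        (intervalIntegrable_inner_flux hi₁ h₁.continuousOn_source le_rfl ht.1 ht.2 _)
        (intervalIntegrable_inner_flux hi₂ h₂.continuousOn_source le_rfl ht.1 ht.2 _)]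
    congr 2 with s
    rw [← inner_sub_left]
    congr 1
    module

lemma IsWeakSolution.const_smul (h : IsWeakSolution Γ T f u) (c : ℝ) :
    IsWeakSolution Γ T (fun t => c • f t) (fun t => c • u t) := by
  obtain ⟨D, hi, hg, he⟩ := h.exists_gradient
  refine ⟨h.continuousOn.const_smul c, h.continuousOn_source.const_smul c, fun t => c • D t,
    hi.smul c, ?_, ?_⟩
  · filter_upwards [hg] with t h using Γ.smul_mem c h
  · intro v hv t ht
    rw [real_inner_smul_left, real_inner_smul_left, he v hv t ht, mul_add,
      ← intervalIntegral.integral_const_mul]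
    congr 2 with s
    rw [← real_inner_smul_left]
    congr 1
    module

/-- A closed convex set contains averages of functions valued in it; a subspace then also contains
the integral. -/
lemma integral_prodMk_mem [CompleteSpace H] [CompleteSpace G]
    (hΓ : IsClosed (Γ : Set (H × G))) {Du : ℝ → G} {s t : ℝ} (hst : s ≤ t)
    (hu : IntervalIntegrable u volume s t) (hD : IntervalIntegrable Du volume s t)
    (h : ∀ᵐ x ∂volume.restrict (Ioc s t), (u x, Du x) ∈ Γ) :
    (∫ x in s..t, u x, ∫ x in s..t, Du x) ∈ Γ := by
  rcases hst.eq_or_lt with rfl | hst'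
  · simp only [intervalIntegral.integral_same]
    exact Γ.zero_mem
  have hmem := Γ.convex.set_average_mem hΓ (μ := volume) (t := Ioc s t)
    (by simp [hst']) (by simp) h (hu.1.prodMk hD.1)
  rw [setAverage_eq] at hmem
  have := Γ.smul_mem (volume.real (Ioc s t)) hmem
  rw [smul_inv_smul₀ (by simp [hst'.le, (sub_pos.2 hst').ne']), integral_pair hu.1 hD.1] at this
  rwa [intervalIntegral.integral_of_le hst, intervalIntegral.integral_of_le hst]

lemma IsWeakSolution.inner_integral_sub_le [CompleteSpace H] [CompleteSpace G]
    (hΓ : IsClosed (Γ : Set (H × G)))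
    (h : IsWeakSolution Γ T f u) {s t : ℝ} (hs : 0 ≤ s) (hst : s ≤ t) (ht : t ≤ T) :
    ⟪∫ x in s..t, u x, u t - u s⟫ ≤ 1 / 2 * ‖∫ x in s..t, f x‖ ^ 2 := by
  obtain ⟨Du, hi, hg, he⟩ := h.exists_gradient
  have iu := intervalIntegrable_of_continuousOn_Icc h.continuousOn hs hst ht
  have iD := intervalIntegrable_of_integrableOn_Ioo hi hs hst ht
  have jf := intervalIntegrable_of_continuousOn_Icc h.continuousOn_source hs hst ht
  have hmem := integral_prodMk_mem hΓ hst iu iD (by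
    rw [← restrict_Ioo_eq_restrict_Ioc]
    exact ae_restrict_of_ae_restrict_of_subset (Ioo_subset_Ioo hs ht) hg)
  set D := ∫ x in s..t, Du x with hD
  set F := ∫ x in s..t, f x with hF
  have e₁ := he _ hmem t ⟨hs.trans hst, ht⟩
  have e₂ := he _ hmem s ⟨hs, hst.trans ht⟩
  have hsplit := intervalIntegral.integral_add_adjacent_intervals
    (intervalIntegrable_inner_flux hi h.continuousOn_source le_rfl hs (hst.trans ht) D)
    (intervalIntegrable_inner_flux hi h.continuousOn_source hs hst ht D)
  have hflux : ∫ x in s..t, ⟪-(1 / 2 : ℝ) • Du x + f x, D⟫ = -(1 / 2) * ‖D‖ ^ 2 + ⟪F, D⟫ := by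
    have h1 : ∫ x in s..t, (-(1 / 2 : ℝ) • Du x + f x) = -(1 / 2 : ℝ) • D + F := by
      rw [hD, hF, ← intervalIntegral.integral_smul]
      exact intervalIntegral.integral_add (iD.smul (-(1 / 2 : ℝ))) jf
    have h2 := (innerSL ℝ D).intervalIntegral_comp_comm ((iD.smul (-(1 / 2 : ℝ))).add jf)
    simp only [innerSL_apply_apply, Pi.smul_apply] at h2
    simp_rw [fun x => real_inner_comm D x]
    rw [h2, h1, inner_add_right, real_inner_smul_right, real_inner_self_eq_norm_sq]
  -- Young's inequality `⟪F, D⟫ ≤ ½‖F‖² + ½‖D‖²`: the diffusion term absorbs `½‖D‖²` exactly.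
  have hsq : 0 ≤ ‖F - D‖ ^ 2 := by positivity
  rw [norm_sub_sq_real] at hsq
  rw [real_inner_comm, inner_sub_left]
  linarith

lemma IsWeakSolution.norm_sq_le [CompleteSpace H] [CompleteSpace G]
    (hΓ : IsClosed (Γ : Set (H × G))) (hT : 0 < T)
    (h : IsWeakSolution Γ T f u) {t : ℝ} (ht : t ∈ Icc 0 T) :
    ‖u t‖ ^ 2 ≤ ‖u 0‖ ^ 2 + ∫ s in 0..t, ‖f s‖ ^ 2 :=
  norm_sq_le_of_increment hT h.continuousOn h.continuousOn_source
    (fun _ _ hs hst ht => h.inner_integral_sub_le hΓ hs hst ht) ht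

lemma IsWeakSolution.norm_sq_le_of_norm_source_le [CompleteSpace H] [CompleteSpace G]
    (hΓ : IsClosed (Γ : Set (H × G))) (hT : 0 < T)
    (h : IsWeakSolution Γ T f u) {τ : ℝ} (hτ : τ ∈ Icc 0 T) {β γ : ℝ}
    (hf : ∀ s ∈ Icc 0 τ, ‖f s‖ ≤ β * ‖u s‖ + γ) :
    ‖u τ‖ ^ 2 ≤ (‖u 0‖ ^ 2 + 2 * γ ^ 2 * τ) * Real.exp (2 * β ^ 2 * τ) := by
  have hu : ContinuousOn (fun t => ‖u t‖ ^ 2) (Icc 0 T) := h.continuousOn.norm.pow 2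
  -- Working on `[0, τ]` instead of `[0, T]` keeps the factor `τ` in front of `γ²`.
  refine gronwall_integral (hu.mono (Icc_subset_Icc_right hτ.2)) (by positivity) (fun t ht => ?_)
    τ ⟨hτ.1, le_rfl⟩
  have ht' : t ∈ Icc 0 T := ⟨ht.1, ht.2.trans hτ.2⟩
  have iu : IntervalIntegrable (fun s => 2 * β ^ 2 * ‖u s‖ ^ 2) volume 0 t :=
    (intervalIntegrable_of_continuousOn_Icc hu le_rfl ht'.1 ht'.2).const_mul _
  have hle : ∫ s in 0..t, ‖f s‖ ^ 2 ≤ ∫ s in 0..t, (2 * β ^ 2 * ‖u s‖ ^ 2 + 2 * γ ^ 2) := by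
    refine intervalIntegral.integral_mono_on ht.1
      (intervalIntegrable_of_continuousOn_Icc (h.continuousOn_source.norm.pow 2) le_rfl ht'.1 ht'.2)
      (iu.add intervalIntegrable_const) fun s hs => ?_
    have h1 := pow_le_pow_left₀ (norm_nonneg _) (hf s ⟨hs.1, hs.2.trans ht.2⟩) 2
    nlinarith [sq_nonneg (β * ‖u s‖ - γ)]
  rw [intervalIntegral.integral_add iu intervalIntegrable_const,
    intervalIntegral.integral_const] at hle
  have hmono : t * (2 * γ ^ 2) ≤ τ * (2 * γ ^ 2) :=
    mul_le_mul_of_nonneg_right ht.2 (by positivity)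
  have := h.norm_sq_le hΓ hT ht'
  simp only [sub_zero, smul_eq_mul] at hle
  linarith

end WeakSolution

/-! ### The weak gradient and the drift on the torus -/

section Torus

variable {d : ℕ}

lemma isOpenQuotientMap_torusMk :
    IsOpenQuotientMap fun (x : Fin d → ℝ) (i : Fin d) => (x i : UnitAddCircle) :=
  IsOpenQuotientMap.piMap fun _ => QuotientAddGroup.isOpenQuotientMap_mk

lemma IsSmooth.continuous {φ : UnitAddTorus (Fin d) → ℝ} (hφ : IsSmooth φ) : Continuous φ :=
  isOpenQuotientMap_torusMk.isQuotientMap.continuous_iff.2 (ContDiff.continuous hφ)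

lemma IsSmooth.continuous_partialDeriv {φ : UnitAddTorus (Fin d) → ℝ} (hφ : IsSmooth φ)
    (i : Fin d) : Continuous (partialDeriv i φ) := by
  refine isOpenQuotientMap_torusMk.isQuotientMap.continuous_iff.2 ?_
  set ψ : (Fin d → ℝ) → ℝ := fun x => φ fun j => (x j : UnitAddCircle) with hψ
  have hd : ContDiff ℝ ∞ ψ := hφ
  have key : (partialDeriv i φ ∘ fun (x : Fin d → ℝ) (j : Fin d) => (x j : UnitAddCircle)) =
      fun x => fderiv ℝ ψ x (Pi.single i 1) := by
    funext x
    have hline : (fun s : ℝ => φ ((fun j => (x j : UnitAddCircle)) +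
        Pi.single i (s : UnitAddCircle))) = fun s : ℝ => ψ (x + s • Pi.single i 1) := by
      funext s
      simp only [hψ]
      congr 1
      funext j
      rcases eq_or_ne j i with rfl | hj
      · simp
      · simp [hj]
    simp only [Function.comp_apply, partialDeriv]
    rw [hline]
    exact ((hd.differentiable (by simp) x).hasFDerivAt.hasLineDerivAt _).deriv
  rw [key]
  exact (hd.continuous_fderiv (by simp)).clm_apply continuous_const

/-- Pairing `Du` with the field `φ eᵢ` isolates its `i`-th component. -/
lemma IsSmooth.continuous_euclideanSpaceSingle {φ : UnitAddTorus (Fin d) → ℝ} (hφ : IsSmooth φ) (i : Fin d) :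
    Continuous fun y => EuclideanSpace.single i (φ y) :=
  (PiLp.continuous_toLp 2 _).comp ((_root_.continuous_single i).comp hφ.continuous)

lemma memLp_of_continuous {E : Type*} [NormedAddCommGroup E] {φ : UnitAddTorus (Fin d) → E}
    (hφ : Continuous φ) : MemLp φ 2 (torusMeasure d) :=
  hφ.memLp_of_hasCompactSupport (HasCompactSupport.of_compactSpace φ)

/-- The closed graph of the weak gradient, whose domain is `H¹(𝕋ᵈ)`. -/
noncomputable def weakGradientGraph (d : ℕ) : Submodule ℝ (L2 d × L2Vec d) :=
  ⨅ (φ : {φ : UnitAddTorus (Fin d) → ℝ // IsSmooth φ}) (i : Fin d),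
    LinearMap.ker
      ((innerSL ℝ (memLp_of_continuous (φ.2.continuous_partialDeriv i)).toLp).comp
          (ContinuousLinearMap.fst ℝ (L2 d) (L2Vec d)) +
        (innerSL ℝ (memLp_of_continuous (φ.2.continuous_euclideanSpaceSingle i)).toLp).comp
          (ContinuousLinearMap.snd ℝ (L2 d) (L2Vec d)) : L2 d × L2Vec d →L[ℝ] ℝ).toLinearMap

lemma isClosed_weakGradientGraph : IsClosed (weakGradientGraph d : Set (L2 d × L2Vec d)) := by
  simp only [weakGradientGraph, Submodule.coe_iInf]
  exact isClosed_iInter fun φ => isClosed_iInter fun i => ContinuousLinearMap.isClosed_ker _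

lemma mem_weakGradientGraph {u : L2 d} {Du : L2Vec d} :
    (u, Du) ∈ weakGradientGraph d ↔ IsWeakGradient u Du := by
  simp only [weakGradientGraph, Submodule.mem_iInf, IsWeakGradient, Subtype.forall]
  refine forall_congr' fun φ => forall_congr' fun hφ => forall_congr' fun i => ?_
  rw [LinearMap.mem_ker, eq_neg_iff_add_eq_zero]
  refine Eq.congr (congrArg₂ (fun a b : ℝ => a + b) ?_ ?_) rfl
  · refine (L2.inner_def _ _).trans (integral_congr_ae ?_)
    filter_upwards [(memLp_of_continuous (hφ.continuous_partialDeriv i)).coeFn_toLp] with y hy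
    simp [hy]
  · refine (L2.inner_def _ _).trans (integral_congr_ae ?_)
    filter_upwards [(memLp_of_continuous (hφ.continuous_euclideanSpaceSingle i)).coeFn_toLp] with y hy
    simp [hy, EuclideanSpace.inner_single_left, mul_comm]

/-- Multiplication of scalar functions in `L²` by the bounded vector field `g`. -/
noncomputable def drift : LInftyVec d →L[ℝ] L2 d →L[ℝ] L2Vec d :=
  ((ContinuousLinearMap.lsmul ℝ ℝ).holderL (torusMeasure d) 2 ∞ 2).flip

lemma coeFn_drift (g : LInftyVec d) (u : L2 d) :
    drift g u =ᵐ[torusMeasure d] fun y => u y • g y :=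
  ContinuousLinearMap.coeFn_holder (r := 2) (ContinuousLinearMap.lsmul ℝ ℝ) u g

lemma norm_drift_le (g : LInftyVec d) (u : L2 d) : ‖drift g u‖ ≤ ‖g‖ * ‖u‖ := by
  refine (ContinuousLinearMap.norm_holder_apply_apply_le (r := 2)
    (ContinuousLinearMap.lsmul ℝ ℝ) u g).trans ?_
  have h := ContinuousLinearMap.opNorm_lsmul_le (𝕜 := ℝ) (R := ℝ) (E := EuclideanSpace ℝ (Fin d))
  rw [mul_assoc, mul_comm ‖g‖]
  exact mul_le_of_le_one_left (by positivity) h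

lemma IsVariationalSolution.isWeakSolution {T : ℝ} {g : LInftyVec d}
    {F : ℝ → UnitAddTorus (Fin d) → EuclideanSpace ℝ (Fin d)} {u₀ : L2 d} {u : ℝ → L2 d}
    (h : IsVariationalSolution T g F u₀ u) {f : ℝ → L2Vec d} (hf : ContinuousOn f (Icc 0 T))
    (hF : ∀ t, f t =ᵐ[torusMeasure d] F t) :
    IsWeakSolution (weakGradientGraph d) T (fun t => drift g (u t) + f t) u := by
  obtain ⟨Du, hD, hg, he⟩ := h.exists_gradient
  refine ⟨h.continuousOn, ((drift g).continuous.comp_continuousOn h.continuousOn).add hf, Du,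
    hD.integrable one_le_two, ?_, ?_⟩
  · filter_upwards [hg] with t ht using mem_weakGradientGraph.2 ht
  · rintro ⟨v, Dv⟩ hv t ht
    have := he v Dv (mem_weakGradientGraph.1 hv) t ht
    rw [h.initial]
    have hin : ∀ w : L2 d, ⟪w, v⟫ = ∫ y, w y * v y ∂torusMeasure d := fun w => by
      rw [L2.inner_def]
      refine integral_congr_ae (Eventually.of_forall fun y => ?_)
      simp [mul_comm]
    rw [hin, hin, this]
    congr 2 with s
    rw [inner_add_left, real_inner_smul_left, L2.inner_def, L2.inner_def]
    congr 1
    refine integral_congr_ae ?_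
    filter_upwards [Lp.coeFn_add (drift g (u s)) (f s), coeFn_drift g (u s), hF s] with y h1 h2 h3
    rw [h1, Pi.add_apply, h2, h3]

end Torus

/-! ### Difference quotient and linearisation error -/

section Sensitivity

variable {d : ℕ} {T : ℝ} {b η : LInftyVec d} {p₀ : L2 d}

lemma norm_add_smul_le {δ : ℝ} (hδ : δ ∈ Icc (0 : ℝ) 1) : ‖b + δ • η‖ ≤ ‖b‖ + ‖η‖ := by
  refine (norm_add_le _ _).trans (add_le_add_right ?_ _)
  rw [norm_smul, Real.norm_of_nonneg hδ.1]
  exact mul_le_of_le_one_left (norm_nonneg _) hδ.2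

lemma IsFokkerPlanckSolution.isWeakSolution {g : LInftyVec d} {p : ℝ → L2 d}
    (h : IsFokkerPlanckSolution T g p₀ p) :
    IsWeakSolution (weakGradientGraph d) T (fun t => drift g (p t) + 0) p :=
  IsVariationalSolution.isWeakSolution h continuousOn_const fun _ => Lp.coeFn_zero _ _ _

lemma IsFokkerPlanckSolution.norm_le (hT : 0 < T) {g : LInftyVec d} {p : ℝ → L2 d}
    (h : IsFokkerPlanckSolution T g p₀ p) {β : ℝ} (hg : ‖g‖ ≤ β) {t : ℝ} (ht : t ∈ Icc 0 T) :
    ‖p t‖ ≤ ‖p₀‖ * Real.exp (β ^ 2 * T) := by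
  have := h.isWeakSolution.norm_sq_le_of_norm_source_le isClosed_weakGradientGraph hT ht
    (β := β) (γ := 0) fun s _ => by
      rw [add_zero, add_zero]
      exact (norm_drift_le g (p s)).trans (mul_le_mul_of_nonneg_right hg (norm_nonneg _))
  rw [h.initial] at this
  refine le_of_sq_le_sq ?_ (by positivity)
  calc ‖p t‖ ^ 2 ≤ ‖p₀‖ ^ 2 * Real.exp (2 * β ^ 2 * t) := by simpa using this
    _ ≤ ‖p₀‖ ^ 2 * Real.exp (2 * β ^ 2 * T) := by
      gcongr
      exact ht.2
    _ = (‖p₀‖ * Real.exp (β ^ 2 * T)) ^ 2 := by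
      rw [mul_pow, ← Real.exp_nat_mul]
      congr 2
      push_cast
      ring

variable {p q : ℝ → L2 d} {r : ℝ → L2 d} {δ : ℝ}

/-- Splitting `(b + δ η) q - b p = b (q - p) + δ η q` puts the perturbed solution `q` in the
forcing. -/
lemma isWeakSolution_differenceQuotient (hδ : δ ≠ 0)
    (hp : IsFokkerPlanckSolution T b p₀ p) (hq : IsFokkerPlanckSolution T (b + δ • η) p₀ q) :
    IsWeakSolution (weakGradientGraph d) T
      (fun t => drift b (δ⁻¹ • (q t - p t)) + drift η (q t)) (fun t => δ⁻¹ • (q t - p t)) := by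
  have := (hq.isWeakSolution.sub hp.isWeakSolution).const_smul δ⁻¹
  convert this using 2 with t
  simp only [map_add, map_smul, map_sub, _root_.add_apply,
    _root_.smul_apply, add_zero]
  rw [add_sub_right_comm, smul_add, smul_smul, inv_mul_cancel₀ hδ, one_smul]

lemma isWeakSolution_remainder (hδ : δ ≠ 0)
    (hp : IsFokkerPlanckSolution T b p₀ p) (hq : IsFokkerPlanckSolution T (b + δ • η) p₀ q)
    (hr : IsLinearisedSolution T b η p r) :
    IsWeakSolution (weakGradientGraph d) T
      (fun t => drift b (δ⁻¹ • (q t - p t) - r t) + drift η (δ • δ⁻¹ • (q t - p t)))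
      (fun t => δ⁻¹ • (q t - p t) - r t) := by
  have hr' := IsVariationalSolution.isWeakSolution hr
    ((drift η).continuous.comp_continuousOn hp.continuousOn) fun t => coeFn_drift η (p t)
  have := (isWeakSolution_differenceQuotient hδ hp hq).sub hr'
  convert this using 2 with t
  rw [smul_inv_smul₀ hδ]
  simp only [map_sub, Function.comp_apply]
  abel

lemma norm_sq_differenceQuotient_le (hT : 0 < T) (hδ : δ ≠ 0)
    (hp : IsFokkerPlanckSolution T b p₀ p) (hq : IsFokkerPlanckSolution T (b + δ • η) p₀ q)
    {M : ℝ} (hM : ∀ t ∈ Icc 0 T, ‖q t‖ ≤ M) {t : ℝ} (ht : t ∈ Icc 0 T) :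
    ‖δ⁻¹ • (q t - p t)‖ ^ 2 ≤ 2 * (‖η‖ * M) ^ 2 * t * Real.exp (2 * ‖b‖ ^ 2 * t) := by
  have := (isWeakSolution_differenceQuotient hδ hp hq).norm_sq_le_of_norm_source_le
    isClosed_weakGradientGraph hT ht (β := ‖b‖) (γ := ‖η‖ * M) fun s hs =>
      (norm_add_le _ _).trans (add_le_add (norm_drift_le _ _) ((norm_drift_le _ _).trans
        (mul_le_mul_of_nonneg_left (hM s ⟨hs.1, hs.2.trans ht.2⟩) (norm_nonneg _))))
  simpa [hp.initial, hq.initial] using this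

/-- The linearisation error of the Fokker–Planck flow is of order `δ τ`. -/
lemma norm_remainder_le (hT : 0 < T) (hδ : δ ∈ Ioo (0 : ℝ) 1)
    (hp : IsFokkerPlanckSolution T b p₀ p) (hq : IsFokkerPlanckSolution T (b + δ • η) p₀ q)
    (hr : IsLinearisedSolution T b η p r) {τ : ℝ} (hτ : τ ∈ Icc 0 T) :
    ‖δ⁻¹ • (q τ - p τ) - r τ‖ ≤
      2 * ‖η‖ ^ 2 * Real.exp ((‖b‖ + ‖η‖) ^ 2 * T) * Real.exp (2 * ‖b‖ ^ 2 * T) *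
        δ * τ * ‖p₀‖ := by
  have hδ' := hδ.1.ne'
  have hδ0 := hδ.1
  have hτ0 := hτ.1
  set M := ‖p₀‖ * Real.exp ((‖b‖ + ‖η‖) ^ 2 * T) with hM
  set L := Real.exp (2 * ‖b‖ ^ 2 * T) with hL
  set Q := 2 * (‖η‖ * M) ^ 2 * τ * L with hQ
  have hL0 : 0 < L := Real.exp_pos _
  have hM0 : 0 ≤ M := by positivity
  have hQ0 : 0 ≤ Q := by positivity
  have hexp : ∀ s ≤ T, Real.exp (2 * ‖b‖ ^ 2 * s) ≤ L := fun s hs => by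
    rw [hL]
    gcongr
  -- `Q` is proportional to `τ`; the second energy estimate supplies another `τ`, hence `τ²` before
  -- the square root.
  have hquot : ∀ s ∈ Icc 0 τ, ‖δ⁻¹ • (q s - p s)‖ ≤ √Q := fun s hs => by
    refine Real.le_sqrt_of_sq_le ((norm_sq_differenceQuotient_le hT hδ' hp hq
      (fun t ht => hq.norm_le hT (norm_add_smul_le ⟨hδ.1.le, hδ.2.le⟩) ht)
      ⟨hs.1, hs.2.trans hτ.2⟩).trans ?_)
    exact mul_le_mul (mul_le_mul_of_nonneg_left hs.2 (by positivity))
      (hexp s (hs.2.trans hτ.2)) (Real.exp_pos _).le (by positivity)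
  have key := (isWeakSolution_remainder hδ' hp hq hr).norm_sq_le_of_norm_source_le
    isClosed_weakGradientGraph hT hτ (β := ‖b‖) (γ := ‖η‖ * (δ * √Q)) fun s hs => by
      refine (norm_add_le _ _).trans (add_le_add (norm_drift_le _ _)
        ((norm_drift_le _ _).trans (mul_le_mul_of_nonneg_left ?_ (norm_nonneg _))))
      rw [norm_smul, Real.norm_of_nonneg hδ.1.le]
      exact mul_le_mul_of_nonneg_left (hquot s hs) hδ.1.le
  have h0 : δ⁻¹ • (q 0 - p 0) - r 0 = 0 := by
    rw [hq.initial, hp.initial, hr.initial, sub_self, smul_zero, sub_zero]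
  rw [h0, norm_zero, zero_pow two_ne_zero, zero_add] at key
  refine le_of_sq_le_sq ?_ (by positivity)
  calc ‖δ⁻¹ • (q τ - p τ) - r τ‖ ^ 2
      ≤ 2 * (‖η‖ * (δ * √Q)) ^ 2 * τ * L :=
        key.trans (mul_le_mul_of_nonneg_left (hexp τ hτ.2) (by positivity))
    _ = 2 * (‖η‖ * δ) ^ 2 * Q * τ * L := by
        rw [← mul_assoc ‖η‖, mul_pow _ (√Q), Real.sq_sqrt hQ0]
        ring
    _ = _ := by
        rw [hQ, hM]
        ring

end Sensitivity

end TorusFP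


theorem proposition3 :
    ∃ C : ℝ → ℝ → ℝ → ℕ → ℝ, (∀ β ε T d, 0 < C β ε T d) ∧
      ∀ (d : ℕ) (T : ℝ), 0 < T →
      ∀ (b η : TorusFP.LInftyVec d) (p₀ : TorusFP.L2 d)
        (p : ℝ → ℝ → TorusFP.L2 d) (r : ℝ → TorusFP.L2 d),
        (∀ δ ∈ Set.Ico (0 : ℝ) 1, TorusFP.IsFokkerPlanckSolution T (b + δ • η) p₀ (p δ)) →
        TorusFP.IsLinearisedSolution T b η (p 0) r →
        (∀ τ ∈ Set.Ioo 0 T, ∀ δ ∈ Set.Ioo (0 : ℝ) 1,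
          ‖δ⁻¹ • (p δ τ - p 0 τ) - r τ‖ ≤ C ‖b‖ ‖η‖ T d * δ * τ * ‖p₀‖) ∧
        (∀ δ ∈ Set.Ioo (0 : ℝ) 1, ∀ τ ∈ Set.Icc 0 T,
          ‖δ⁻¹ • (p δ τ - p 0 τ) - r τ‖ ≤ C ‖b‖ ‖η‖ T d * δ * T * ‖p₀‖) ∧
        ∀ τ ∈ Set.Icc 0 T,
          Filter.Tendsto (fun δ : ℝ => δ⁻¹ • (p δ τ - p 0 τ)) (nhdsWithin 0 (Set.Ioi 0))
            (nhds (r τ)) := by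
  -- The summand `1` only secures positivity when `ε = 0`.
  refine ⟨fun β ε T _ => 2 * ε ^ 2 * Real.exp ((β + ε) ^ 2 * T) * Real.exp (2 * β ^ 2 * T) + 1,
    fun β ε T _ => by positivity, fun d T hT b η p₀ p r hp hr => ?_⟩
  set C := 2 * ‖η‖ ^ 2 * Real.exp ((‖b‖ + ‖η‖) ^ 2 * T) * Real.exp (2 * ‖b‖ ^ 2 * T) + 1 with hC
  have hC0 : 0 < C := by positivity
  have hp0 : TorusFP.IsFokkerPlanckSolution T b p₀ (p 0) := by
    simpa using hp 0 ⟨le_rfl, one_pos⟩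
  have main : ∀ τ ∈ Set.Icc 0 T, ∀ δ ∈ Set.Ioo (0 : ℝ) 1,
      ‖δ⁻¹ • (p δ τ - p 0 τ) - r τ‖ ≤ C * δ * τ * ‖p₀‖ := fun τ hτ δ hδ => by
    refine (TorusFP.norm_remainder_le hT hδ hp0 (hp δ ⟨hδ.1.le, hδ.2⟩) hr hτ).trans ?_
    have hδ0 := hδ.1.le
    have hτ0 := hτ.1
    gcongr
    linarith
  have unif : ∀ δ ∈ Set.Ioo (0 : ℝ) 1, ∀ τ ∈ Set.Icc 0 T,
      ‖δ⁻¹ • (p δ τ - p 0 τ) - r τ‖ ≤ C * δ * T * ‖p₀‖ := fun δ hδ τ hτ => by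
    refine (main τ hτ δ hδ).trans ?_
    have hδ0 := hδ.1.le
    gcongr
    exact hτ.2
  refine ⟨fun τ hτ => main τ ⟨hτ.1.le, hτ.2.le⟩, unif, fun τ hτ => ?_⟩
  rw [tendsto_iff_norm_sub_tendsto_zero]
  refine squeeze_zero' (.of_forall fun δ => norm_nonneg _) (g := fun δ => C * δ * T * ‖p₀‖) ?_ ?_
  · filter_upwards [Ioo_mem_nhdsGT one_pos] with δ hδ using unif δ hδ τ hτ
  · have : Continuous fun δ : ℝ => C * δ * T * ‖p₀‖ := by fun_prop
    simpa using (this.tendsto 0).mono_left nhdsWithin_le_nhds
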